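/- For $k \in \mathbb{Z}$ let $\mathcal{U}_k$ be the affine scheme over $\mathbb{Z}$ defined by $$x^2+y^2+z^2+4(x^2y^2+y^2z^2+z^2x^2)-16x^2y^2z^2=k,$$ let $U_k=\mathcal{U}_k\times_{\mathbb{Z}}\mathbb{Q}$ be its generic fibre, and let $\mathcal{U}_k(\mathbf{A}_{\mathbb{Z}})=\mathcal{U}_k(\mathbb{R})\times\prod_p\mathcal{U}_k(\mathbb{Z}_p)$, the product being over all primes $p$. For a class $\mathcal{A}\in\mathrm{Br}\,U_k$ let $$\mathcal{U}_k(\mathbf{A}_{\mathbb{Z}})^{\mathcal{A}}=\Big\{(P_v)_v\in\mathcal{U}_k(\mathbf{A}_{\mathbb{Z}}) : \sum_{v}\mathrm{inv}_v\,\mathcal{A}(P_v)=0\in\mathbb{Q}/\mathbb{Z}\Big\},$$ where $v$ runs over all places of $\mathbb{Q}$ and $\mathrm{inv}_v:\mathrm{Br}\,\mathbb{Q}_v\to\mathbb{Q}/\mathbb{Z}$ is the local invariant map. **Proposition.** Let $k\equiv 1 \pmod 4$ and suppose $\mathcal{U}_k(\mathbb{Z})\neq\emptyset$. Then the quaternion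 algebra $(4x^2+1,\,-2(4k+1))$, defined on the open subset of $U_k$ where $4x^2+1\neq 0$, extends to an Azumaya algebra on $U_k$ and so defines a class $\mathcal{A}_1\in\mathrm{Br}\,U_k$; and there is a Brauer--Manin obstruction to strong approximation on $\mathcal{U}_k$ with respect to $\mathcal{A}_1$, that is, $$\mathcal{U}_k(\mathbf{A}_{\mathbb{Z}})^{\mathcal{A}_1}\neq\mathcal{U}_k(\mathbf{A}_{\mathbb{Z}}).$$ An example is $k=-2911$: here $k\equiv1\pmod 4$ and $(1,4,4)\in\mathcal{U}_k(\mathbb{Z})$. -/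

import Mathlib

open scoped TensorProduct Quaternion

namespace MarkoffK3

/-- The polynomial `x² + y² + z² + 4(x²y² + y²z² + z²x²) - 16x²y²z²`; the affine surface `U_k` and
its integral model `𝒰_k` are given by `form x y z = k`. -/
def form {T : Type*} [CommRing T] (x y z : T) : T :=
  x ^ 2 + y ^ 2 + z ^ 2 + 4 * (x ^ 2 * y ^ 2 + y ^ 2 * z ^ 2 + z ^ 2 * x ^ 2)
    - 16 * x ^ 2 * y ^ 2 * z ^ 2

/-- The set `𝒰_k(T)` of points of the affine scheme `form x y z = k` with values in a ring `T`. -/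
@[ext]
structure Point (k : ℤ) (T : Type*) [CommRing T] where
  x : T
  y : T
  z : T
  eqn : form x y z = (k : T)

/-- Functoriality `𝒰_k(T) → 𝒰_k(T')` along a ring homomorphism. -/
def Point.map {k : ℤ} {T T' : Type*} [CommRing T] [CommRing T'] (φ : T →+* T') (P : Point k T) :
    Point k T' where
  x := φ P.x
  y := φ P.y
  z := φ P.z
  eqn := by
    have h := congrArg φ P.eqn
    simpa [form, map_ofNat] using h

/-- The ideal of `ℚ[x, y, z]` generated by `form x y z - k`. -/
noncomputable def surfaceIdeal (k : ℤ) : Ideal (MvPolynomial (Fin 3) ℚ) :=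
  Ideal.span {form (MvPolynomial.X 0) (MvPolynomial.X 1) (MvPolynomial.X 2) - MvPolynomial.C (k : ℚ)}

/-- The coordinate ring `ℚ[U_k] = ℚ[x, y, z] / (form x y z - k)`. -/
def CoordRing (k : ℤ) : Type := MvPolynomial (Fin 3) ℚ ⧸ surfaceIdeal k

noncomputable instance (k : ℤ) : CommRing (CoordRing k) :=
  inferInstanceAs (CommRing (MvPolynomial (Fin 3) ℚ ⧸ surfaceIdeal k))

noncomputable instance (k : ℤ) : Algebra ℚ (CoordRing k) :=
  inferInstanceAs (Algebra ℚ (MvPolynomial (Fin 3) ℚ ⧸ surfaceIdeal k))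

/-- The quotient map `ℚ[x, y, z] → ℚ[U_k]`. -/
noncomputable def toCoordRing (k : ℤ) : MvPolynomial (Fin 3) ℚ →ₐ[ℚ] CoordRing k :=
  Ideal.Quotient.mkₐ ℚ (surfaceIdeal k)

/-- Evaluation of functions on `U_k` at a point over a field of characteristic zero. -/
noncomputable def Point.eval {k : ℤ} {F : Type*} [Field F] [CharZero F] (P : Point k F) :
    CoordRing k →ₐ[ℚ] F :=
  Ideal.Quotient.liftₐ (surfaceIdeal k) (MvPolynomial.aeval ![P.x, P.y, P.z]) (by
    intro a ha
    rw [surfaceIdeal, Ideal.mem_span_singleton] at ha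
    obtain ⟨b, rfl⟩ := ha
    have h := P.eqn
    simp only [form] at h
    simp [form, h])

theorem Point.eval_toCoordRing {k : ℤ} {F : Type*} [Field F] [CharZero F] (P : Point k F)
    (f : MvPolynomial (Fin 3) ℚ) :
    P.eval (toCoordRing k f) = MvPolynomial.aeval ![P.x, P.y, P.z] f :=
  rfl

/-- The function `4x² + 1` on `U_k`. -/
noncomputable def slotOne (k : ℤ) : CoordRing k :=
  4 * toCoordRing k (MvPolynomial.X 0) ^ 2 + 1

/-- The constant `-2(4k + 1)`. -/
def slotTwo (k : ℤ) : ℤ := -2 * (4 * k + 1)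

/-- The coordinate ring of the dense open subset `V = {4x² + 1 ≠ 0}` of `U_k`. -/
def OpenRing (k : ℤ) : Type := Localization.Away (slotOne k)

noncomputable instance (k : ℤ) : CommRing (OpenRing k) :=
  inferInstanceAs (CommRing (Localization.Away (slotOne k)))

noncomputable instance (k : ℤ) : Algebra (CoordRing k) (OpenRing k) :=
  inferInstanceAs (Algebra (CoordRing k) (Localization.Away (slotOne k)))

instance (k : ℤ) : IsLocalization.Away (slotOne k) (OpenRing k) :=
  inferInstanceAs (IsLocalization.Away (slotOne k) (Localization.Away (slotOne k)))

/-- `𝒜` represents the class `𝒜₁ = (4x² + 1, -2(4k + 1))` in the Brauer group of `U_k`: it is an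
Azumaya algebra on the whole affine surface `U_k`, and its restriction to `V = {4x² + 1 ≠ 0}` is the
quaternion algebra with `i² = 4x² + 1`, `j² = -2(4k + 1)`, `ij = -ji`. (When `U_k` is smooth,
`Br U_k → Br V` is injective, so this determines the Brauer class of `𝒜`.) -/
def RepresentsA₁ (k : ℤ) (𝒜 : Type) [Ring 𝒜] [Algebra (CoordRing k) 𝒜] : Prop :=
  IsAzumaya (CoordRing k) 𝒜 ∧
    Nonempty ((OpenRing k ⊗[CoordRing k] 𝒜) ≃ₐ[OpenRing k]
      ℍ[OpenRing k, algebraMap (CoordRing k) (OpenRing k) (slotOne k),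
        (slotTwo k : OpenRing k)])

/-- The fibre of `𝒜` at the point `P ∈ U_k(F)`, the `F`-algebra `F ⊗ 𝒜` formed along
evaluation at `P`, is split, i.e. its class in `Br F` is trivial. -/
def SplitAt {k : ℤ} (𝒜 : Type) [Ring 𝒜] [Algebra (CoordRing k) 𝒜]
    {F : Type} [Field F] [CharZero F] (P : Point k F) : Prop :=
  letI : Algebra (CoordRing k) F := P.eval.toRingHom.toAlgebra
  ∃ n : ℕ, 0 < n ∧ Nonempty ((F ⊗[CoordRing k] 𝒜) ≃ₐ[F] Matrix (Fin n) (Fin n) F)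

open Classical in
/-- The local invariant `inv_v 𝒜(P) ∈ ℚ/ℤ` at a point `P ∈ U_k(ℚ_v)`, for an Azumaya algebra `𝒜`
whose class is killed by `2`, as is the class of a quaternion algebra: for `F = ℝ` or `F = ℚ_p`
the group `Br F` has exactly one element of order `2`, and its invariant is `1/2`. -/
noncomputable def localInv {k : ℤ} (𝒜 : Type) [Ring 𝒜] [Algebra (CoordRing k) 𝒜]
    {F : Type} [Field F] [CharZero F] (P : Point k F) : AddCircle (1 : ℚ) :=
  if SplitAt 𝒜 P then 0 else ((1 / 2 : ℚ) : AddCircle (1 : ℚ))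

/-- The set `𝒰_k(A_ℤ) = 𝒰_k(ℝ) × ∏_p 𝒰_k(ℤ_p)`. -/
structure AdelicPoint (k : ℤ) where
  atReal : Point k ℝ
  atPrime : ∀ (p : ℕ) [Fact p.Prime], Point k ℤ_[p]

/-- The Brauer–Manin pairing `∑_v inv_v 𝒜(P_v) ∈ ℚ/ℤ` of an adelic point with the class of `𝒜`
(only finitely many terms are nonzero when `𝒜` is an Azumaya algebra on `U_k`). -/
noncomputable def pairing {k : ℤ} (𝒜 : Type) [Ring 𝒜] [Algebra (CoordRing k) 𝒜]
    (P : AdelicPoint k) : AddCircle (1 : ℚ) :=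
  localInv 𝒜 P.atReal +
    ∑ᶠ p : Nat.Primes,
      haveI : Fact (p : ℕ).Prime := ⟨p.2⟩
      localInv 𝒜 ((P.atPrime (p : ℕ)).map (algebraMap ℤ_[(p : ℕ)] ℚ_[(p : ℕ)]))

/-- The Brauer–Manin set `𝒰_k(A_ℤ)^𝒜`, as a subset of `𝒰_k(A_ℤ)`. -/
def brauerManinSet (k : ℤ) (𝒜 : Type) [Ring 𝒜] [Algebra (CoordRing k) 𝒜] :
    Set (AdelicPoint k) :=
  {P | pairing 𝒜 P = 0}

end MarkoffK3

/-! Put a = 4x² + 1 and b = -2(4k + 1). On the surface (4x² + 1)(4y² + 1)(4z² + 1) = 4k + 1 +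
128x²y²z², so b = w² + ac with w = 16xyz and c = -2(4y² + 1)(4z² + 1) (`slotTwo_eq`). The Clifford
algebra of the form a s² + 2w st - c t² therefore has discriminant b up to units. As b is a nonzero
constant, this algebra is Azumaya everywhere, and it becomes (a, b) once a is inverted
(`BinaryClifford.isAzumaya`, `baseChangeEquiv`).

The obstruction comes from the prime 2. If x is even, a is a square in ℤ₂ and the invariant is 0. If
x is odd, a ≡ 5 mod 8 while b is twice a unit, so (a, b) is a division algebra over ℚ₂ and the
invariant is 1/2. For k ≡ 1 mod 4 an integral point has coordinates of both parities, and permuting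
them gives integral points P, Q with x even and x odd. The adelic point P everywhere and the one
with Q in place of P at 2 have pairings differing by 1/2, so they cannot both vanish. -/

namespace MarkoffK3

/-! ### Clifford algebras of binary forms are Azumaya -/

/-- The Clifford algebra of the binary quadratic form `a s² + 2 w s t - c t²` over `R`: the free
module on `1, i, u, j` with `i² = a`, `u² = -c`, `i u = w + j`, `u i = w - j`, whence
`j² = w² + a c`. -/
@[ext]
structure BinaryClifford {R : Type*} (a w c : R) where
  re : R
  imI : R
  imU : R
  imJ : R

namespace BinaryClifford

variable {R : Type*} [CommRing R] {a w c : R}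

instance : Zero (BinaryClifford a w c) := ⟨⟨0, 0, 0, 0⟩⟩
instance : One (BinaryClifford a w c) := ⟨⟨1, 0, 0, 0⟩⟩
instance : Add (BinaryClifford a w c) :=
  ⟨fun x y => ⟨x.re + y.re, x.imI + y.imI, x.imU + y.imU, x.imJ + y.imJ⟩⟩
instance : Neg (BinaryClifford a w c) := ⟨fun x => ⟨-x.re, -x.imI, -x.imU, -x.imJ⟩⟩
instance : Mul (BinaryClifford a w c) :=
  ⟨fun x y =>
    ⟨x.re * y.re + a * x.imI * y.imI - c * x.imU * y.imU + (w ^ 2 + a * c) * x.imJ * y.imJ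
        + w * (x.imI * y.imU + x.imU * y.imI),
      x.re * y.imI + x.imI * y.re - w * (x.imI * y.imJ - x.imJ * y.imI)
        + c * (x.imU * y.imJ - x.imJ * y.imU),
      x.re * y.imU + x.imU * y.re + a * (x.imI * y.imJ - x.imJ * y.imI)
        + w * (x.imU * y.imJ - x.imJ * y.imU),
      x.re * y.imJ + x.imJ * y.re + (x.imI * y.imU - x.imU * y.imI)⟩⟩

@[simp] theorem re_zero : (0 : BinaryClifford a w c).re = 0 := rfl
@[simp] theorem imI_zero : (0 : BinaryClifford a w c).imI = 0 := rfl
@[simp] theorem imU_zero : (0 : BinaryClifford a w c).imU = 0 := rfl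
@[simp] theorem imJ_zero : (0 : BinaryClifford a w c).imJ = 0 := rfl
@[simp] theorem re_one : (1 : BinaryClifford a w c).re = 1 := rfl
@[simp] theorem imI_one : (1 : BinaryClifford a w c).imI = 0 := rfl
@[simp] theorem imU_one : (1 : BinaryClifford a w c).imU = 0 := rfl
@[simp] theorem imJ_one : (1 : BinaryClifford a w c).imJ = 0 := rfl

section

variable (x y : BinaryClifford a w c)

@[simp] theorem re_add : (x + y).re = x.re + y.re := rfl
@[simp] theorem imI_add : (x + y).imI = x.imI + y.imI := rfl
@[simp] theorem imU_add : (x + y).imU = x.imU + y.imU := rfl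
@[simp] theorem imJ_add : (x + y).imJ = x.imJ + y.imJ := rfl
@[simp] theorem re_neg : (-x).re = -x.re := rfl
@[simp] theorem imI_neg : (-x).imI = -x.imI := rfl
@[simp] theorem imU_neg : (-x).imU = -x.imU := rfl
@[simp] theorem imJ_neg : (-x).imJ = -x.imJ := rfl
@[simp] theorem re_mul : (x * y).re =
    x.re * y.re + a * x.imI * y.imI - c * x.imU * y.imU + (w ^ 2 + a * c) * x.imJ * y.imJ
      + w * (x.imI * y.imU + x.imU * y.imI) := rfl
@[simp] theorem imI_mul : (x * y).imI =
    x.re * y.imI + x.imI * y.re - w * (x.imI * y.imJ - x.imJ * y.imI)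
      + c * (x.imU * y.imJ - x.imJ * y.imU) := rfl
@[simp] theorem imU_mul : (x * y).imU =
    x.re * y.imU + x.imU * y.re + a * (x.imI * y.imJ - x.imJ * y.imI)
      + w * (x.imU * y.imJ - x.imJ * y.imU) := rfl
@[simp] theorem imJ_mul : (x * y).imJ =
    x.re * y.imJ + x.imJ * y.re + (x.imI * y.imU - x.imU * y.imI) := rfl

end

instance : AddCommGroup (BinaryClifford a w c) where
  add_assoc x y z := by ext <;> simp [add_assoc]
  zero_add x := by ext <;> simp
  add_zero x := by ext <;> simp
  add_comm x y := by ext <;> simp [add_comm]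
  neg_add_cancel x := by ext <;> simp
  nsmul := nsmulRec
  zsmul := zsmulRec

instance : Ring (BinaryClifford a w c) where
  mul_assoc x y z := by ext <;> simp <;> ring
  one_mul x := by ext <;> simp
  mul_one x := by ext <;> simp
  zero_mul x := by ext <;> simp
  mul_zero x := by ext <;> simp
  left_distrib x y z := by ext <;> simp <;> ring
  right_distrib x y z := by ext <;> simp <;> ring
  neg_add_cancel := neg_add_cancel
  zsmul := zsmulRec

instance : Algebra R (BinaryClifford a w c) where
  smul r x := ⟨r * x.re, r * x.imI, r * x.imU, r * x.imJ⟩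
  algebraMap :=
    { toFun := fun r => ⟨r, 0, 0, 0⟩
      map_one' := rfl
      map_mul' := fun r s => by ext <;> simp
      map_zero' := rfl
      map_add' := fun r s => by ext <;> simp }
  commutes' r x := by ext <;> simp <;> ring
  smul_def' r x := by
    ext
    · change r * x.re = _
      simp
    · change r * x.imI = _
      simp
    · change r * x.imU = _
      simp
    · change r * x.imJ = _
      simp

section

variable (r : R) (x : BinaryClifford a w c)

@[simp] theorem re_smul : (r • x).re = r * x.re := rfl
@[simp] theorem imI_smul : (r • x).imI = r * x.imI := rfl
@[simp] theorem imU_smul : (r • x).imU = r * x.imU := rfl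
@[simp] theorem imJ_smul : (r • x).imJ = r * x.imJ := rfl

end

/-- The generator `i`, of square `a`. -/
def i : BinaryClifford a w c := ⟨0, 1, 0, 0⟩

/-- The generator `u`, of square `-c`. -/
def u : BinaryClifford a w c := ⟨0, 0, 1, 0⟩

/-- The element `j = i u - w`, of square `w² + a c`. -/
def j : BinaryClifford a w c := ⟨0, 0, 0, 1⟩

theorem eq_combination (x : BinaryClifford a w c) :
    x = x.re • 1 + x.imI • i + x.imU • u + x.imJ • j := by
  ext <;> simp [i, u, j]

/-- The coordinates with respect to `1, i, u, j`. -/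
def coordEquiv : BinaryClifford a w c ≃ₗ[R] (Fin 4 → R) where
  toFun x := ![x.re, x.imI, x.imU, x.imJ]
  invFun v := ⟨v 0, v 1, v 2, v 3⟩
  map_add' x y := by ext n; fin_cases n <;> rfl
  map_smul' r x := by ext n; fin_cases n <;> rfl
  left_inv x := rfl
  right_inv v := by ext n; fin_cases n <;> rfl

/-- The basis `1, i, u, j`. -/
noncomputable def basis : Module.Basis (Fin 4) R (BinaryClifford a w c) :=
  .ofEquivFun coordEquiv

instance : Module.Free R (BinaryClifford a w c) := .of_basis basis
instance : Module.Finite R (BinaryClifford a w c) := .of_basis basis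

instance : FaithfulSMul R (BinaryClifford a w c) where
  eq_of_smul_eq_smul {r s} h := by
    simpa using congrArg re (h 1)

/-- For the bilinear form given by the `re` part of a product, the right-hand factors are w² + ac
times the dual basis of 1, i, u, j. The left side is thus a multiple of the Casimir element acting
on x, which yields a multiple of the reduced trace 2 `x.re`. -/
theorem casimir (x : BinaryClifford a w c) :
    (w ^ 2 + a * c) • x + j * x * j + i * x * (c • i + w • u) + u * x * (w • i - a • u)
      = (4 * (w ^ 2 + a * c) * x.re) • 1 := by
  rw [sub_eq_add_neg]
  ext <;> simp [i, u, j] <;> ring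

/-- The Casimir element acts as projection to the `re` part. Multiplying it on both sides gives
every rank-one map x ↦ re(xz) y, and these span the endomorphisms. -/
theorem mulLeftRight_surjective (h : IsUnit (4 * (w ^ 2 + a * c))) :
    Function.Surjective (AlgHom.mulLeftRight R (BinaryClifford a w c)) := by
  set φ := AlgHom.mulLeftRight R (BinaryClifford a w c) with hφ
  obtain ⟨e, he⟩ := h.exists_right_inv
  let T : BinaryClifford a w c ⊗[R] (BinaryClifford a w c)ᵐᵒᵖ :=
    e • ((w ^ 2 + a * c) • ((1 : BinaryClifford a w c) ⊗ₜ MulOpposite.op 1)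
      + j ⊗ₜ MulOpposite.op j + i ⊗ₜ MulOpposite.op (c • i + w • u)
      + u ⊗ₜ MulOpposite.op (w • i - a • u))
  have hT : ∀ x, φ T x = x.re • 1 := by
    intro x
    have : φ T x = e • ((w ^ 2 + a * c) • x + j * x * j + i * x * (c • i + w • u)
        + u * x * (w • i - a • u)) := by
      simp [T, hφ]
    rw [this, casimir, smul_smul, ← mul_assoc, mul_comm e, he, one_mul]
  let S (y z : BinaryClifford a w c) :=
    (y ⊗ₜ MulOpposite.op 1) * T * ((1 : BinaryClifford a w c) ⊗ₜ MulOpposite.op z)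
  have hS : ∀ y z x, φ (S y z) x = (x * z).re • y := by
    intro y z x
    have h1 : φ ((1 : BinaryClifford a w c) ⊗ₜ MulOpposite.op z) x = x * z := by simp [hφ]
    have h2 : ∀ t, φ (y ⊗ₜ MulOpposite.op 1) t = y * t := by simp [hφ]
    simp only [S, map_mul, Module.End.mul_apply]
    rw [h1, hT, h2, mul_smul_comm, mul_one]
  intro f
  -- This expands f in the dual basis; 4e is the inverse of w² + ac.
  refine ⟨S (f 1) 1 + (4 * e) • (S (f i) (c • i + w • u) + S (f u) (w • i - a • u)
    + S (f j) j), ?_⟩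
  ext1 x
  conv_rhs => rw [eq_combination x]
  simp only [map_add, map_smul, LinearMap.add_apply, LinearMap.smul_apply, hS, smul_add, smul_smul,
    mul_one, add_assoc]
  congr 1
  congr 1
  · congr 1
    simp [i, u]
    linear_combination x.imI * he
  congr 1
  · congr 1
    rw [sub_eq_add_neg]
    simp [i, u]
    linear_combination x.imU * he
  · congr 1
    simp [j]
    linear_combination x.imJ * he

/-- Source and target are free of rank 16, so surjectivity already forces injectivity. -/
theorem isAzumaya (h : IsUnit (4 * (w ^ 2 + a * c))) :
    IsAzumaya R (BinaryClifford a w c) where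
  bij := by
    have hs := mulLeftRight_surjective h
    refine ⟨?_, hs⟩
    let b₁ : Module.Basis (Fin 4 × Fin 4) R
        (BinaryClifford a w c ⊗[R] (BinaryClifford a w c)ᵐᵒᵖ) :=
      basis.tensorProduct (basis.map (MulOpposite.opLinearEquiv R))
    let b₂ : Module.Basis (Fin 4 × Fin 4) R (Module.End R (BinaryClifford a w c)) :=
      basis.linearMap basis
    let e := b₂.equiv b₁ (Equiv.refl _)
    have hi := OrzechProperty.injective_of_surjective_endomorphism
      (e.toLinearMap ∘ₗ (AlgHom.mulLeftRight R (BinaryClifford a w c)).toLinearMap)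
      (e.surjective.comp hs)
    exact Function.Injective.of_comp (f := e) hi

end BinaryClifford

/-! ### Base change to quaternion algebras -/

namespace BinaryClifford

variable {R : Type*} [CommRing R] {a w c : R} (S : Type*) [CommRing S] [Algebra R S]

/-- If `a` becomes invertible in `S`, with inverse `d`, then `u ↦ d (w i + i j)` defines a
homomorphism from the Clifford algebra to the quaternion algebra `(a, w² + a c)` over `S`. -/
def toQuaternion (d : S) (hd : algebraMap R S a * d = 1) :
    BinaryClifford a w c →ₐ[R] ℍ[S, algebraMap R S a, algebraMap R S (w ^ 2 + a * c)] :=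
  AlgHom.ofLinearMap
    { toFun := fun x =>
        ⟨algebraMap R S x.re, algebraMap R S x.imI + d * algebraMap R S w * algebraMap R S x.imU,
          algebraMap R S x.imJ, d * algebraMap R S x.imU⟩
      map_add' := fun x y => by ext <;> simp <;> ring
      map_smul' := fun r x => by ext <;> simp <;> simp only [Algebra.smul_def] <;> ring }
    (by ext <;> simp)
    (fun x y => by
      ext <;> simp
      · linear_combination (- algebraMap R S w * (algebraMap R S x.imI * algebraMap R S y.imU
          + algebraMap R S x.imU * algebraMap R S y.imI)
          + algebraMap R S c * (algebraMap R S x.imU * algebraMap R S y.imU)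
            * (1 + algebraMap R S a * d)) * hd
      · linear_combination (algebraMap R S w * (algebraMap R S x.imI * algebraMap R S y.imJ
          - algebraMap R S x.imJ * algebraMap R S y.imI)
          - algebraMap R S c * (algebraMap R S x.imU * algebraMap R S y.imJ
          - algebraMap R S x.imJ * algebraMap R S y.imU)) * hd
      · linear_combination (algebraMap R S x.imU * algebraMap R S y.imI
          - algebraMap R S x.imI * algebraMap R S y.imU) * hd
      · linear_combination (algebraMap R S x.imI * algebraMap R S y.imJ
          - algebraMap R S x.imJ * algebraMap R S y.imI) * hd)

/-- Over an extension `S` of `R` in which `a` becomes invertible, the Clifford algebra becomes the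
quaternion algebra `(a, w² + a c)`. -/
noncomputable def baseChangeEquiv (h : IsUnit (algebraMap R S a)) :
    S ⊗[R] BinaryClifford a w c ≃ₐ[S]
      ℍ[S, algebraMap R S a, algebraMap R S (w ^ 2 + a * c)] :=
  let d := h.exists_right_inv.choose
  have hd : algebraMap R S a * d = 1 := h.exists_right_inv.choose_spec
  let φ := AlgHom.liftEquiv R S (BinaryClifford a w c) _ (toQuaternion S d hd)
  -- The inverse sends k = ij to i(iu - w) = a u - w i.
  let ψ : ℍ[S, algebraMap R S a, algebraMap R S (w ^ 2 + a * c)] →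
      S ⊗[R] BinaryClifford a w c := fun q =>
    q.re ⊗ₜ 1 + (q.imI - algebraMap R S w * q.imK) ⊗ₜ i + (algebraMap R S a * q.imK) ⊗ₜ u
      + q.imJ ⊗ₜ j
  have hφ : ∀ s x, φ (s ⊗ₜ x) = s • toQuaternion S d hd x := fun s x => by
    simp [φ]
  AlgEquiv.ofBijective φ (by
    constructor
    · refine Function.LeftInverse.injective (g := ψ) fun t => ?_
      induction t with
      | zero => simp [ψ]
      | add x y hx hy =>
        rw [map_add]
        conv_rhs => rw [← hx, ← hy]
        simp only [ψ, QuaternionAlgebra.re_add, QuaternionAlgebra.imI_add,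
          QuaternionAlgebra.imJ_add, QuaternionAlgebra.imK_add, mul_add, TensorProduct.add_tmul,
          TensorProduct.sub_tmul]
        abel
      | tmul s x =>
        conv_rhs => rw [eq_combination x]
        simp only [hφ, ψ, TensorProduct.tmul_add, TensorProduct.tmul_smul, TensorProduct.smul_tmul']
        congr 1
        · congr 1
          · congr 1
            · congr 1
              simp [toQuaternion]
              simp only [Algebra.smul_def]
              ring
            · congr 1
              simp [toQuaternion]
              simp only [Algebra.smul_def]
              ring
          · congr 1
            simp [toQuaternion]
            simp only [Algebra.smul_def]
            linear_combination s * algebraMap R S x.imU * hd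
        · congr 1
          simp [toQuaternion]
          simp only [Algebra.smul_def]
          ring
    · refine Function.RightInverse.surjective (g := ψ) fun q => ?_
      simp only [ψ, map_add, hφ]
      ext <;> simp [toQuaternion, i, u, j]
      · linear_combination algebraMap R S w * q.imK * hd
      · linear_combination q.imK * hd)

end BinaryClifford

/-- Base change of an algebra along `R → S → T` can be performed in two steps. -/
noncomputable def cancelBaseChange (R S T A : Type*) [CommRing R] [CommRing S] [CommRing T] [Ring A]
    [Algebra R S] [Algebra R T] [Algebra S T] [IsScalarTower R S T] [Algebra R A] :
    T ⊗[R] A ≃ₐ[T] T ⊗[S] (S ⊗[R] A) :=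
  AlgEquiv.ofLinearEquiv (TensorProduct.AlgebraTensorModule.cancelBaseChange R S T T A).symm
    (by simp [Algebra.TensorProduct.one_def])
    (LinearMap.map_mul_of_map_mul_tmul fun _ _ _ _ => by simp)

section QuaternionBaseChange

variable {R : Type*} [CommRing R] (a b : R) (S : Type*) [CommRing S] [Algebra R S]

/-- The quaternion algebra over `R` maps to the quaternion algebra with the same parameters over an
`R`-algebra. -/
def quaternionMap : ℍ[R, a, b] →ₐ[R] ℍ[S, algebraMap R S a, algebraMap R S b] :=
  AlgHom.ofLinearMap
    { toFun := fun q =>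
        ⟨algebraMap R S q.re, algebraMap R S q.imI, algebraMap R S q.imJ, algebraMap R S q.imK⟩
      map_add' := fun x y => by ext <;> simp
      map_smul' := fun r x => by ext <;> simp <;> simp only [Algebra.smul_def] }
    (by ext <;> simp)
    (fun x y => by ext <;> simp)

/-- Quaternion algebras are compatible with base change. -/
noncomputable def quaternionBaseChange :
    S ⊗[R] ℍ[R, a, b] ≃ₐ[S] ℍ[S, algebraMap R S a, algebraMap R S b] :=
  let φ := AlgHom.liftEquiv R S ℍ[R, a, b] _ (quaternionMap a b S)
  let ψ : ℍ[S, algebraMap R S a, algebraMap R S b] → S ⊗[R] ℍ[R, a, b] := fun q =>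
    q.re ⊗ₜ ⟨1, 0, 0, 0⟩ + q.imI ⊗ₜ ⟨0, 1, 0, 0⟩ + q.imJ ⊗ₜ ⟨0, 0, 1, 0⟩ + q.imK ⊗ₜ ⟨0, 0, 0, 1⟩
  have hφ : ∀ s x, φ (s ⊗ₜ x) = s • quaternionMap a b S x := fun s x => by
    simp [φ]
  AlgEquiv.ofBijective φ (by
    constructor
    · refine Function.LeftInverse.injective (g := ψ) fun t => ?_
      induction t with
      | zero => simp [ψ]
      | add x y hx hy =>
        rw [map_add]
        conv_rhs => rw [← hx, ← hy]
        simp only [ψ, QuaternionAlgebra.re_add, QuaternionAlgebra.imI_add,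
          QuaternionAlgebra.imJ_add, QuaternionAlgebra.imK_add, TensorProduct.add_tmul]
        abel
      | tmul s x =>
        have hx : x = x.re • ⟨1, 0, 0, 0⟩ + x.imI • ⟨0, 1, 0, 0⟩ + x.imJ • ⟨0, 0, 1, 0⟩
            + x.imK • ⟨0, 0, 0, 1⟩ := by ext <;> simp
        conv_rhs => rw [hx]
        simp only [hφ, ψ, TensorProduct.tmul_add, TensorProduct.tmul_smul,
          TensorProduct.smul_tmul']
        simp [quaternionMap, Algebra.smul_def, mul_comm s]
    · refine Function.RightInverse.surjective (g := ψ) fun q => ?_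
      simp only [ψ, map_add, hφ]
      ext <;> simp [quaternionMap])

end QuaternionBaseChange

/-! ### The class on the surface and its fibres -/

theorem toCoordRing_form (k : ℤ) :
    form (toCoordRing k (MvPolynomial.X 0)) (toCoordRing k (MvPolynomial.X 1))
      (toCoordRing k (MvPolynomial.X 2)) = (k : CoordRing k) := by
  have h : toCoordRing k (form (MvPolynomial.X 0) (MvPolynomial.X 1) (MvPolynomial.X 2)
      - MvPolynomial.C (k : ℚ)) = 0 :=
    Ideal.Quotient.eq_zero_iff_mem.2 (Ideal.subset_span rfl)
  rw [map_sub, sub_eq_zero] at h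
  simpa [form, map_ofNat] using h

/-- On the surface, `-2(4k + 1)` is a square modulo `4x² + 1`. -/
theorem slotTwo_eq (k : ℤ) :
    (slotTwo k : CoordRing k) =
      (16 * toCoordRing k (MvPolynomial.X 0) * toCoordRing k (MvPolynomial.X 1)
          * toCoordRing k (MvPolynomial.X 2)) ^ 2
        + slotOne k * (-2 * (4 * toCoordRing k (MvPolynomial.X 1) ^ 2 + 1)
          * (4 * toCoordRing k (MvPolynomial.X 2) ^ 2 + 1)) := by
  simp only [slotTwo, Int.cast_mul, Int.cast_add, Int.cast_neg, Int.cast_ofNat, Int.cast_one,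
    ← toCoordRing_form k, form, slotOne]
  ring

theorem slotTwo_ne_zero (k : ℤ) : slotTwo k ≠ 0 := by
  unfold slotTwo
  omega

/-- The discriminant is a nonzero rational constant, hence a unit of the coordinate ring, so nothing
goes wrong along 4x² + 1 = 0. -/
theorem exists_representsA₁ (k : ℤ) :
    ∃ (𝒜 : Type) (_ : Ring 𝒜) (_ : Algebra (CoordRing k) 𝒜), RepresentsA₁ k 𝒜 := by
  refine ⟨BinaryClifford (slotOne k)
    (16 * toCoordRing k (MvPolynomial.X 0) * toCoordRing k (MvPolynomial.X 1)
      * toCoordRing k (MvPolynomial.X 2))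
    (-2 * (4 * toCoordRing k (MvPolynomial.X 1) ^ 2 + 1)
      * (4 * toCoordRing k (MvPolynomial.X 2) ^ 2 + 1)),
    inferInstance, inferInstance, BinaryClifford.isAzumaya ?_, ?_⟩
  · rw [← slotTwo_eq]
    have h : ((4 * slotTwo k : ℤ) : ℚ) ≠ 0 :=
      Int.cast_ne_zero.2 (mul_ne_zero four_ne_zero (slotTwo_ne_zero k))
    have hu := h.isUnit.map (algebraMap ℚ (CoordRing k))
    rwa [map_intCast, Int.cast_mul, Int.cast_ofNat] at hu
  · have e := BinaryClifford.baseChangeEquiv (a := slotOne k)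
      (w := 16 * toCoordRing k (MvPolynomial.X 0) * toCoordRing k (MvPolynomial.X 1)
        * toCoordRing k (MvPolynomial.X 2))
      (c := -2 * (4 * toCoordRing k (MvPolynomial.X 1) ^ 2 + 1)
        * (4 * toCoordRing k (MvPolynomial.X 2) ^ 2 + 1)) (OpenRing k)
      (IsLocalization.Away.algebraMap_isUnit (slotOne k))
    rw [← slotTwo_eq, map_intCast] at e
    exact ⟨e⟩

theorem Point.eval_slotOne {k : ℤ} {F : Type*} [Field F] [CharZero F] (P : Point k F) :
    P.eval (slotOne k) = 4 * P.x ^ 2 + 1 := by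
  simp [slotOne, Point.eval_toCoordRing, map_ofNat]

/-- At a point where `4x² + 1 ≠ 0`, an algebra representing `𝒜₁` is split if and only if the
quaternion algebra `(4x² + 1, -2(4k + 1))` is. -/
theorem splitAt_iff {k : ℤ} {𝒜 : Type} [Ring 𝒜] [Algebra (CoordRing k) 𝒜]
    (h : RepresentsA₁ k 𝒜) {F : Type} [Field F] [CharZero F] (P : Point k F)
    (hP : 4 * P.x ^ 2 + 1 ≠ 0) :
    SplitAt 𝒜 P ↔ ∃ n : ℕ, 0 < n ∧
      Nonempty (ℍ[F, 4 * P.x ^ 2 + 1, (slotTwo k : F)] ≃ₐ[F] Matrix (Fin n) (Fin n) F) := by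
  obtain ⟨-, ⟨e⟩⟩ := h
  let _ : Algebra (CoordRing k) F := P.eval.toRingHom.toAlgebra
  have hu : IsUnit (P.eval.toRingHom (slotOne k)) := by
    change IsUnit (P.eval (slotOne k))
    rw [Point.eval_slotOne]
    exact hP.isUnit
  -- Evaluation at P factors through the localization, so the fibre can be computed on V.
  let g : OpenRing k →+* F := IsLocalization.Away.lift (slotOne k) hu
  let _ : Algebra (OpenRing k) F := g.toAlgebra
  have : IsScalarTower (CoordRing k) (OpenRing k) F := IsScalarTower.of_algebraMap_eq fun r =>
    (IsLocalization.Away.lift_eq (slotOne k) hu r).symm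
  have e₁ := cancelBaseChange (CoordRing k) (OpenRing k) F 𝒜
  have e₂ : F ⊗[OpenRing k] (OpenRing k ⊗[CoordRing k] 𝒜) ≃ₐ[F] _ :=
    Algebra.TensorProduct.congr AlgEquiv.refl e
  have e₃ := (e₁.trans e₂).trans (quaternionBaseChange _ _ F)
  rw [map_intCast, ← IsScalarTower.algebraMap_apply,
    show algebraMap (CoordRing k) F (slotOne k) = 4 * P.x ^ 2 + 1 from P.eval_slotOne] at e₃
  constructor
  · rintro ⟨n, hn, ⟨f⟩⟩
    exact ⟨n, hn, ⟨e₃.symm.trans f⟩⟩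
  · rintro ⟨n, hn, ⟨f⟩⟩
    exact ⟨n, hn, ⟨e₃.trans f⟩⟩

/-! ### Split and non-split quaternion algebras -/

section Splitting

variable {F : Type*} [Field F] [CharZero F]

/-- The quaternion algebra `(a, b)` is split when `b` is a norm from `F(√a)`. -/
theorem quaternion_split {a b s t : F} (ha : a ≠ 0) (hb : b ≠ 0) (h : s ^ 2 - a * t ^ 2 = b) :
    Nonempty (ℍ[F, a, b] ≃ₐ[F] Matrix (Fin 2) (Fin 2) F) := by
  -- Action on F[√a] in the basis 1, √a: i is multiplication by √a, and j is conjugation followed by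
  -- multiplication by s + t√a, whose square is the norm b.
  let f : ℍ[F, a, b] →ₐ[F] Matrix (Fin 2) (Fin 2) F := AlgHom.ofLinearMap
    { toFun := fun q =>
        !![q.re + s * q.imJ + a * t * q.imK, a * q.imI - a * t * q.imJ - a * s * q.imK;
          q.imI + t * q.imJ + s * q.imK, q.re - s * q.imJ - a * t * q.imK]
      map_add' := fun x y => by
        ext n m; fin_cases n <;> fin_cases m <;> simp <;> ring
      map_smul' := fun r x => by
        ext n m; fin_cases n <;> fin_cases m <;> simp <;> ring }
    (by ext n m; fin_cases n <;> fin_cases m <;> simp)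
    (fun x y => by
      ext n m
      subst h
      fin_cases n <;> fin_cases m <;> simp [Matrix.mul_apply] <;> ring)
  have hf : Function.Injective f := by
    rw [injective_iff_map_eq_zero]
    intro q hq
    have e00 : q.re + s * q.imJ + a * t * q.imK = 0 := congrFun (congrFun hq 0) 0
    have e01 : a * q.imI - a * t * q.imJ - a * s * q.imK = 0 := congrFun (congrFun hq 0) 1
    have e10 : q.imI + t * q.imJ + s * q.imK = 0 := congrFun (congrFun hq 1) 0
    have e11 : q.re - s * q.imJ - a * t * q.imK = 0 := congrFun (congrFun hq 1) 1
    have h2 : (2 : F) ≠ 0 := two_ne_zero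
    have h0 : q.re = 0 := mul_left_cancel₀ h2 (by linear_combination e00 + e11)
    have h1 : q.imI = 0 :=
      mul_left_cancel₀ (mul_ne_zero h2 ha) (by linear_combination e01 + a * e10)
    have h3 : q.imJ = 0 := mul_left_cancel₀ hb (by
      linear_combination s * e00 - a * t * e10 - s * h0 + a * t * h1 - q.imJ * h)
    have h4 : q.imK = 0 := mul_left_cancel₀ hb (by
      linear_combination -t * e00 + s * e10 + t * h0 - s * h1 - q.imK * h)
    ext <;> simpa
  have hd : Module.finrank F ℍ[F, a, b] = Module.finrank F (Matrix (Fin 2) (Fin 2) F) := by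
    rw [QuaternionAlgebra.finrank_eq_four, Module.finrank_matrix]
    simp
  exact ⟨AlgEquiv.ofBijective f
    ⟨hf, (LinearMap.injective_iff_surjective_of_finrank_eq_finrank (f := f.toLinearMap) hd).1 hf⟩⟩

/-- A quaternion algebra with anisotropic norm form is not a matrix algebra. -/
theorem not_quaternion_equiv_matrix {a b : F}
    (h : ∀ p q r s : F, p ^ 2 - a * q ^ 2 - b * r ^ 2 + a * b * s ^ 2 = 0 →
      p = 0 ∧ q = 0 ∧ r = 0 ∧ s = 0) {n : ℕ} (hn : 0 < n) :
    ¬ Nonempty (ℍ[F, a, b] ≃ₐ[F] Matrix (Fin n) (Fin n) F) := by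
  rintro ⟨f⟩
  obtain rfl | hn := Nat.eq_or_lt_of_le (Nat.succ_le_of_lt hn)
  · have hc : ∀ x y : ℍ[F, a, b], x * y = y * x := fun x y => f.injective (by
      rw [map_mul, map_mul]
      ext n m
      simp only [Matrix.mul_apply, Subsingleton.elim n 0, Subsingleton.elim m 0]
      simp [mul_comm])
    have := congrArg QuaternionAlgebra.imK (hc ⟨0, 1, 0, 0⟩ ⟨0, 0, 1, 0⟩)
    simp only [QuaternionAlgebra.imK_mul] at this
    norm_num at this
  -- For n ≥ 2 there is x ≠ 0 with x² = 0; multiplying by the conjugate of x gives N(x) x = 0, so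
  -- N(x) = 0.
  · let E : Matrix (Fin n) (Fin n) F := Matrix.single ⟨0, by omega⟩ ⟨1, hn⟩ 1
    have hE : E ≠ 0 := fun h0 => by
      simpa [E] using congrFun (congrFun h0 ⟨0, by omega⟩) ⟨1, hn⟩
    have hEE : E * E = 0 := by simp [E]
    set x := f.symm E with hx
    have hx0 : x ≠ 0 := by simpa [hx] using hE
    have hxx : x * x = 0 := by rw [hx, ← map_mul, hEE, map_zero]
    let N := x.re ^ 2 - a * x.imI ^ 2 - b * x.imJ ^ 2 + a * b * x.imK ^ 2
    have hN : (⟨x.re, -x.imI, -x.imJ, -x.imK⟩ : ℍ[F, a, b]) * x = ⟨N, 0, 0, 0⟩ := by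
      ext <;> simp [N] <;> ring
    have hNx : N • x = 0 := by
      have : N • x = (⟨N, 0, 0, 0⟩ : ℍ[F, a, b]) * x := by ext <;> simp
      rw [this, ← hN, mul_assoc, hxx, mul_zero]
    obtain ⟨h0, h1, h2, h3⟩ := h _ _ _ _ ((smul_eq_zero.1 hNx).resolve_right hx0)
    exact hx0 (by ext <;> simpa)

end Splitting

/-! ### Norm forms over the p-adic integers -/

section Padic

variable {p : ℕ} [Fact p.Prime]

theorem exists_sq_eq_of_norm_lt {c s : ℤ_[p]} (h : ‖s ^ 2 - c‖ < ‖2 * s‖ ^ 2) :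
    ∃ z : ℤ_[p], z ^ 2 = c := by
  obtain ⟨z, hz, -⟩ := hensels_lemma (p := p) (R := ℤ_[p])
    (F := Polynomial.X ^ 2 - Polynomial.C c) (a := s) (by simpa [one_add_one_eq_two] using h)
  exact ⟨z, by simpa [sub_eq_zero] using hz⟩

/-- A unit is a norm from an unramified quadratic extension. -/
theorem exists_norm_eq (hp : p ≠ 2) {a b : ℤ} (ha : ¬ (p : ℤ) ∣ a) (hb : ¬ (p : ℤ) ∣ b) :
    ∃ s t : ℤ_[p], s ^ 2 - a * t ^ 2 = b := by
  have haz : (a : ZMod p) ≠ 0 := by rwa [Ne, ZMod.intCast_zmod_eq_zero_iff_dvd]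
  have hnu : ∀ m : ℤ, ¬ (p : ℤ) ∣ m → ‖(m : ℤ_[p])‖ = 1 := fun m hm =>
    le_antisymm (PadicInt.norm_le_one _)
      (not_lt.1 fun h => hm ((PadicInt.norm_int_lt_one_iff_dvd m).1 h))
  have h2 : ‖(2 : ℤ_[p])‖ = 1 := by
    have := hnu 2 fun h => hp ((Nat.prime_dvd_prime_iff_eq Fact.out Nat.prime_two).1
      (by exact_mod_cast h))
    simpa using this
  -- The equation is solvable over 𝔽ₚ; as p ∤ b, some coordinate of the solution is a unit, and
  -- Hensel lifts that one with the other fixed.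
  obtain ⟨s₀, t₀, hst⟩ := FiniteField.exists_root_sum_quadratic
    (f := Polynomial.X ^ 2 - Polynomial.C (b : ZMod p))
    (g := Polynomial.C (-(a : ZMod p)) * Polynomial.X ^ 2)
    (Polynomial.degree_X_pow_sub_C two_pos _)
    (Polynomial.degree_C_mul_X_pow 2 (neg_ne_zero.2 haz))
    (by rw [ZMod.card]; exact (Fact.out : p.Prime).mod_two_eq_one_iff_ne_two.2 hp)
  obtain ⟨S, rfl⟩ := ZMod.intCast_surjective s₀
  obtain ⟨T, rfl⟩ := ZMod.intCast_surjective t₀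
  have hd : (p : ℤ) ∣ S ^ 2 - b - a * T ^ 2 := by
    rw [← ZMod.intCast_zmod_eq_zero_iff_dvd]
    simp at hst
    push_cast
    linear_combination hst
  have hn := (PadicInt.norm_int_lt_one_iff_dvd _).2 hd
  push_cast at hn
  by_cases hS : (p : ℤ) ∣ S
  · have hT : ¬ (p : ℤ) ∣ T := fun hT => hb (by
      have := ((hS.pow two_ne_zero).sub ((hT.pow two_ne_zero).mul_left a)).sub hd
      ring_nf at this
      exact this)
    obtain ⟨d, hd⟩ := (PadicInt.isUnit_iff.2 (hnu a ha)).exists_right_inv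
    obtain ⟨t, ht⟩ := exists_sq_eq_of_norm_lt (c := d * ((S : ℤ_[p]) ^ 2 - (b : ℤ_[p])))
      (s := (T : ℤ_[p])) (by
      rw [norm_mul, h2, hnu T hT, one_mul, one_pow]
      have : (T : ℤ_[p]) ^ 2 - d * ((S : ℤ_[p]) ^ 2 - b)
          = -d * ((S : ℤ_[p]) ^ 2 - b - a * (T : ℤ_[p]) ^ 2) := by
        linear_combination - (T : ℤ_[p]) ^ 2 * hd
      rw [this]
      exact PadicInt.norm_lt_one_mul hn)
    exact ⟨S, t, by rw [ht]; linear_combination (b - (S : ℤ_[p]) ^ 2) * hd⟩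
  · obtain ⟨s, hs⟩ := exists_sq_eq_of_norm_lt (c := (b : ℤ_[p]) + (a : ℤ_[p]) * (T : ℤ_[p]) ^ 2)
      (s := (S : ℤ_[p])) (by
      rw [norm_mul, h2, hnu S hS, one_mul, one_pow]
      convert hn using 2
      ring)
    exact ⟨s, T, by rw [hs]; ring⟩

theorem eq_two_mul_or (z : ℤ_[2]) : ∃ m, z = 2 * m ∨ z = 2 * m + 1 := by
  obtain ⟨n, hn⟩ : ∃ n : ℤ, (2 : ℤ_[2]) ∣ z - n := by
    obtain ⟨n, hn⟩ := ZMod.intCast_surjective (PadicInt.toZMod z)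
    refine ⟨n, ?_⟩
    have : z - n ∈ RingHom.ker (PadicInt.toZMod (p := 2)) := by
      simp [RingHom.mem_ker, hn]
    rwa [PadicInt.ker_toZMod, PadicInt.maximalIdeal_eq_span_p, Ideal.mem_span_singleton] at this
  obtain ⟨m, hm⟩ := hn
  obtain ⟨l, rfl | rfl⟩ := Int.even_or_odd' n
  · refine ⟨m + l, .inl ?_⟩
    push_cast at hm
    linear_combination hm
  · refine ⟨m + l, .inr ?_⟩
    push_cast at hm
    linear_combination hm

theorem not_two_dvd_one : ¬ (2 : ℤ_[2]) ∣ 1 := fun h =>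
  PadicInt.p_nonunit (p := 2) (isUnit_of_dvd_one h)

/-- Odd squares are 1 mod 8, so the form is 1 - 5 ≡ 4 mod 8 when p and q are both odd, and it is odd
when their parities differ. -/
theorem norm_form_even {e p q : ℤ_[2]} (h : 2 ∣ p ^ 2 - (5 + 8 * e) * q ^ 2) :
    (2 ∣ p ∧ 2 ∣ q) ∨ ∃ g, p ^ 2 - (5 + 8 * e) * q ^ 2 = 4 + 8 * g := by
  have hsq : ∀ m : ℤ_[2], ∃ n, (2 * m + 1) ^ 2 = 1 + 8 * n := by
    intro m
    obtain ⟨n, rfl | rfl⟩ := eq_two_mul_or m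
    · exact ⟨n * (2 * n + 1), by ring⟩
    · exact ⟨(2 * n + 1) * (n + 1), by ring⟩
  obtain ⟨f, hf⟩ := h
  obtain ⟨m, rfl | rfl⟩ := eq_two_mul_or p <;> obtain ⟨n, rfl | rfl⟩ := eq_two_mul_or q
  · exact .inl ⟨⟨m, rfl⟩, ⟨n, rfl⟩⟩
  · exact (not_two_dvd_one ⟨2 * m ^ 2 - (5 + 8 * e) * (2 * n ^ 2 + 2 * n) - 2 - 4 * e - f,
      by linear_combination -hf⟩).elim
  · exact (not_two_dvd_one ⟨-(2 * m ^ 2 + 2 * m) + (5 + 8 * e) * (2 * n ^ 2) + f,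
      by linear_combination hf⟩).elim
  · obtain ⟨m', hm⟩ := hsq m
    obtain ⟨n', hn⟩ := hsq n
    rw [hm, hn]
    exact .inr ⟨m' - e - (5 + 8 * e) * n' - 1, by ring⟩

theorem four_dvd_norm_form {e p q : ℤ_[2]} (h : 2 ∣ p ^ 2 - (5 + 8 * e) * q ^ 2) :
    4 ∣ p ^ 2 - (5 + 8 * e) * q ^ 2 := by
  obtain ⟨⟨m, rfl⟩, ⟨n, rfl⟩⟩ | ⟨g, hg⟩ := norm_form_even h
  · exact ⟨m ^ 2 - (5 + 8 * e) * n ^ 2, by ring⟩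
  · exact ⟨1 + 2 * g, by rw [hg]; ring⟩

theorem two_dvd_of_eight_dvd_norm_form {e p q : ℤ_[2]} (h : 8 ∣ p ^ 2 - (5 + 8 * e) * q ^ 2) :
    2 ∣ p ∧ 2 ∣ q := by
  obtain h' | ⟨g, hg⟩ := norm_form_even (dvd_trans ⟨4, by norm_num⟩ h)
  · exact h'
  · obtain ⟨f, hf⟩ := h
    refine (not_two_dvd_one ⟨f - g, ?_⟩).elim
    have h4 : (4 : ℤ_[2]) ≠ 0 := by norm_num
    apply mul_left_cancel₀ h4
    linear_combination hf - hg

/-- Values of the norm form of the unramified extension have even valuation, which the factor 2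
contradicts. Playing the two sides against each other raises the power of 2 dividing each value to
8, which forces even arguments. -/
theorem quaternion_norm_descent {e c p q r s : ℤ_[2]} (hc : IsUnit c)
    (h : p ^ 2 - (5 + 8 * e) * q ^ 2 = 2 * c * (r ^ 2 - (5 + 8 * e) * s ^ 2)) :
    2 ∣ p ∧ 2 ∣ q ∧ 2 ∣ r ∧ 2 ∣ s := by
  have h2 : (2 : ℤ_[2]) ≠ 0 := by norm_num
  obtain ⟨f, hf⟩ := four_dvd_norm_form (e := e) (p := p) (q := q)
    ⟨c * (r ^ 2 - (5 + 8 * e) * s ^ 2), by rw [h]; ring⟩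
  have hrs : 2 ∣ r ^ 2 - (5 + 8 * e) * s ^ 2 := hc.dvd_mul_left.1
    ⟨f, mul_left_cancel₀ h2 (by linear_combination hf - h)⟩
  obtain ⟨g, hg⟩ := four_dvd_norm_form hrs
  obtain ⟨⟨m, rfl⟩, ⟨n, rfl⟩⟩ := two_dvd_of_eight_dvd_norm_form (e := e) (p := p) (q := q)
    ⟨c * g, by rw [h, hg]; ring⟩
  have hg' : 2 * (m ^ 2 - (5 + 8 * e) * n ^ 2) = c * (r ^ 2 - (5 + 8 * e) * s ^ 2) :=
    mul_left_cancel₀ h2 (by linear_combination h)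
  obtain ⟨f', hf'⟩ := four_dvd_norm_form (e := e) (p := m) (q := n)
    ⟨c * g, mul_left_cancel₀ h2 (by rw [hg', hg]; ring)⟩
  obtain ⟨hr, hs⟩ := two_dvd_of_eight_dvd_norm_form (e := e) (p := r) (q := s)
    (hc.dvd_mul_left.1 ⟨f', by rw [← hg', hf']; ring⟩)
  exact ⟨⟨m, rfl⟩, ⟨n, rfl⟩, hr, hs⟩

theorem quaternion_norm_anisotropic_int {e c p q r s : ℤ_[2]} (hc : IsUnit c)
    (h : p ^ 2 - (5 + 8 * e) * q ^ 2 = 2 * c * (r ^ 2 - (5 + 8 * e) * s ^ 2)) :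
    p = 0 ∧ q = 0 ∧ r = 0 ∧ s = 0 := by
  have key : ∀ (n : ℕ) (p q r s : ℤ_[2]),
      p ^ 2 - (5 + 8 * e) * q ^ 2 = 2 * c * (r ^ 2 - (5 + 8 * e) * s ^ 2) →
      2 ^ n ∣ p ∧ 2 ^ n ∣ q ∧ 2 ^ n ∣ r ∧ 2 ^ n ∣ s := by
    intro n
    induction n with
    | zero => simp
    | succ n ih =>
      intro p q r s h
      obtain ⟨⟨p, rfl⟩, ⟨q, rfl⟩, ⟨r, rfl⟩, ⟨s, rfl⟩⟩ := quaternion_norm_descent hc h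
      have h4 : (4 : ℤ_[2]) ≠ 0 := by norm_num
      obtain ⟨hp, hq, hr, hs⟩ := ih p q r s (mul_left_cancel₀ h4 (by linear_combination h))
      simp only [pow_succ']
      exact ⟨mul_dvd_mul_left 2 hp, mul_dvd_mul_left 2 hq, mul_dvd_mul_left 2 hr,
        mul_dvd_mul_left 2 hs⟩
  have hz : ∀ z : ℤ_[2], (∀ n : ℕ, 2 ^ n ∣ z) → z = 0 := by
    intro z hz
    by_contra hne
    obtain ⟨n, hn⟩ := FiniteMultiplicity.of_not_isUnit (PadicInt.p_nonunit (p := 2)) hne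
    exact hn (hz _)
  exact ⟨hz p fun n => (key n p q r s h).1, hz q fun n => (key n p q r s h).2.1,
    hz r fun n => (key n p q r s h).2.2.1, hz s fun n => (key n p q r s h).2.2.2⟩

/-- The norm form of the quaternion algebra `(a, b)` over `ℚ₂` is anisotropic if `a ≡ 5 mod 8` and
`b` is twice a unit. -/
theorem quaternion_norm_anisotropic {e c : ℤ_[2]} (hc : IsUnit c) {p q r s : ℚ_[2]}
    (h : p ^ 2 - (5 + 8 * e : ℤ_[2]) * q ^ 2 - (2 * c : ℤ_[2]) * r ^ 2
      + (5 + 8 * e : ℤ_[2]) * (2 * c : ℤ_[2]) * s ^ 2 = 0) :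
    p = 0 ∧ q = 0 ∧ r = 0 ∧ s = 0 := by
  obtain ⟨⟨N, hN⟩, hi⟩ := IsLocalization.exist_integer_multiples
    (nonZeroDivisors ℤ_[2]) Finset.univ ![p, q, r, s]
  have hN0 : (N : ℚ_[2]) ≠ 0 := by
    simpa using nonZeroDivisors.ne_zero hN
  obtain ⟨p', hp⟩ := hi 0 (Finset.mem_univ _)
  obtain ⟨q', hq⟩ := hi 1 (Finset.mem_univ _)
  obtain ⟨r', hr⟩ := hi 2 (Finset.mem_univ _)
  obtain ⟨s', hs⟩ := hi 3 (Finset.mem_univ _)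
  replace hp : (p' : ℚ_[2]) = N * p := hp
  replace hq : (q' : ℚ_[2]) = N * q := hq
  replace hr : (r' : ℚ_[2]) = N * r := hr
  replace hs : (s' : ℚ_[2]) = N * s := hs
  have hint : p' ^ 2 - (5 + 8 * e) * q' ^ 2 = 2 * c * (r' ^ 2 - (5 + 8 * e) * s' ^ 2) := by
    apply Subtype.coe_injective
    simp only [PadicInt.coe_sub, PadicInt.coe_mul, PadicInt.coe_pow, hp, hq, hr, hs]
    simp only [PadicInt.coe_mul] at h
    linear_combination (N : ℚ_[2]) ^ 2 * h
  obtain ⟨rfl, rfl, rfl, rfl⟩ := quaternion_norm_anisotropic_int hc hint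
  simp only [PadicInt.coe_zero, zero_eq_mul, hN0, false_or] at hp hq hr hs
  exact ⟨hp, hq, hr, hs⟩

end Padic

/-! ### Local invariants at integral points -/

theorem four_mul_sq_add_one_ne_zero {F : Type*} [Field F] [CharZero F] (x : ℤ) :
    4 * (x : F) ^ 2 + 1 ≠ 0 := by
  have h : 4 * x ^ 2 + 1 ≠ 0 := by positivity
  exact_mod_cast h

/-- The image of an integral point in `U_k(F)`. -/
def Point.ofInt {k : ℤ} (P : Point k ℤ) (F : Type*) [Field F] : Point k F :=
  P.map (Int.castRingHom F)

section LocalInvariants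

variable {k : ℤ} {𝒜 : Type} [Ring 𝒜] [Algebra (CoordRing k) 𝒜]

theorem splitAt_of_norm (h : RepresentsA₁ k 𝒜) (P : Point k ℤ) {F : Type} [Field F] [CharZero F]
    {s t : F} (hst : s ^ 2 - (4 * (P.x : F) ^ 2 + 1) * t ^ 2 = (slotTwo k : F)) :
    SplitAt 𝒜 (P.ofInt F) :=
  (splitAt_iff h (P.ofInt F) (four_mul_sq_add_one_ne_zero P.x)).2
    ⟨2, two_pos, quaternion_split (four_mul_sq_add_one_ne_zero P.x)
      (Int.cast_ne_zero.2 (slotTwo_ne_zero k)) hst⟩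

theorem splitAt_of_not_dvd (h : RepresentsA₁ k 𝒜) (P : Point k ℤ) {p : ℕ} [Fact p.Prime]
    (hp : ¬ (p : ℤ) ∣ 2 * (4 * P.x ^ 2 + 1) * slotTwo k) :
    SplitAt 𝒜 (P.ofInt ℚ_[p]) := by
  have h2 : p ≠ 2 := by
    rintro rfl
    exact hp (dvd_mul_of_dvd_left (dvd_mul_right _ _) _)
  obtain ⟨s, t, hst⟩ := exists_norm_eq h2 (a := 4 * P.x ^ 2 + 1) (b := slotTwo k)
    (fun hd => hp (dvd_mul_of_dvd_left (dvd_mul_of_dvd_right hd _) _))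
    (fun hd => hp (dvd_mul_of_dvd_right hd _))
  refine splitAt_of_norm h P (s := (s : ℚ_[p])) (t := (t : ℚ_[p])) ?_
  push_cast at hst
  have := congrArg (algebraMap ℤ_[p] ℚ_[p]) hst
  simp only [map_sub, map_mul, map_pow, map_add, map_one, map_ofNat, map_intCast] at this
  exact this

theorem splitAt_two_of_even (h : RepresentsA₁ k 𝒜) (P : Point k ℤ) (hx : Even P.x) :
    SplitAt 𝒜 (P.ofInt ℚ_[2]) := by
  obtain ⟨m, hm⟩ := hx.two_dvd
  obtain ⟨z, hz⟩ := exists_sq_eq_of_norm_lt (p := 2) (c := 4 * (P.x : ℤ_[2]) ^ 2 + 1) (s := 1) (by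
    have hn : ‖(2 : ℤ_[2])‖ = 2⁻¹ := by simpa using PadicInt.norm_p (p := 2)
    have : (1 : ℤ_[2]) ^ 2 - (4 * (P.x : ℤ_[2]) ^ 2 + 1) = 2 ^ 4 * (-(m : ℤ_[2]) ^ 2) := by
      rw [hm]
      push_cast
      ring
    rw [this, norm_mul, norm_pow, mul_one, hn]
    have := PadicInt.norm_le_one (-(m : ℤ_[2]) ^ 2)
    nlinarith)
  replace hz : (z : ℚ_[2]) ^ 2 = 4 * (P.x : ℚ_[2]) ^ 2 + 1 := by
    have := congrArg (algebraMap ℤ_[2] ℚ_[2]) hz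
    simp only [map_mul, map_pow, map_add, map_one, map_ofNat, map_intCast] at this
    exact this
  have hz0 : (z : ℚ_[2]) ≠ 0 := by
    intro h0
    rw [h0] at hz
    exact four_mul_sq_add_one_ne_zero (F := ℚ_[2]) P.x (by rw [← hz]; simp)
  -- With a = z², the form s² - (zt)² factors; s + zt = b and s - zt = 1 solve it.
  refine splitAt_of_norm h P (s := ((slotTwo k : ℚ_[2]) + 1) / 2)
    (t := ((slotTwo k : ℚ_[2]) - 1) / (2 * z)) ?_
  rw [← hz]
  field_simp
  ring

theorem not_splitAt_two_of_odd (h : RepresentsA₁ k 𝒜) (P : Point k ℤ) (hx : Odd P.x) :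
    ¬ SplitAt 𝒜 (P.ofInt ℚ_[2]) := by
  rw [splitAt_iff h (P.ofInt ℚ_[2]) (four_mul_sq_add_one_ne_zero P.x)]
  rintro ⟨n, hn, hf⟩
  refine not_quaternion_equiv_matrix (fun p q r s hpq => ?_) hn hf
  obtain ⟨m, hm⟩ := hx
  obtain ⟨l, hl⟩ : ∃ l, m * (m + 1) = 2 * l := (Int.even_mul_succ_self m).two_dvd
  have hc : IsUnit ((-(4 * k + 1) : ℤ) : ℤ_[2]) := by
    rw [PadicInt.isUnit_iff, PadicInt.norm_intCast_eq_one_iff]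
    exact ⟨-1, -2 * k, by push_cast; ring⟩
  -- With x = 2m + 1 and m(m + 1) = 2l, 4x² + 1 = 5 + 16m(m + 1) = 5 + 8·4l.
  refine quaternion_norm_anisotropic (e := ((4 * l : ℤ) : ℤ_[2])) hc ?_
  have ha : ((5 + 8 * ((4 * l : ℤ) : ℤ_[2]) : ℤ_[2]) : ℚ_[2]) = 4 * (P.x : ℚ_[2]) ^ 2 + 1 := by
    have : (5 + 8 * (4 * l) : ℤ) = 4 * P.x ^ 2 + 1 := by
      rw [hm]
      linear_combination -16 * hl
    have := congrArg (Int.cast : ℤ → ℚ_[2]) this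
    push_cast at this ⊢
    exact this
  have hb : ((2 * ((-(4 * k + 1) : ℤ) : ℤ_[2]) : ℤ_[2]) : ℚ_[2]) = (slotTwo k : ℚ_[2]) := by
    have : 2 * ((-(4 * k + 1) : ℤ) : ℤ_[2]) = (slotTwo k : ℤ_[2]) := by
      rw [slotTwo]
      push_cast
      ring
    rw [this, PadicInt.coe_intCast]
  rw [ha, hb]
  exact hpq

end LocalInvariants

/-! ### Comparison of adelic points and conclusion -/

/-- The adelic point whose component at `p` is the integral point `f p`, and whose real component
is `P`. -/
noncomputable def AdelicPoint.ofInt {k : ℤ} (P : Point k ℤ) (f : ℕ → Point k ℤ) : AdelicPoint k where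
  atReal := P.ofInt ℝ
  atPrime p _ := (f p).map (Int.castRingHom ℤ_[p])

theorem one_half_ne_zero : ((1 / 2 : ℚ) : AddCircle (1 : ℚ)) ≠ 0 := by
  rw [Ne, AddCircle.coe_eq_zero_iff]
  rintro ⟨n, hn⟩
  have : (2 * n : ℚ) = 1 := by
    simp at hn
    rw [hn]
    norm_num
  norm_cast at this
  omega

/-- Among two adelic points made of integral points which differ only at the prime `2`, where their
invariants differ, one is not orthogonal to `𝒜`. -/
theorem exists_pairing_ne_zero {k : ℤ} {𝒜 : Type} [Ring 𝒜] [Algebra (CoordRing k) 𝒜]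
    (h : RepresentsA₁ k 𝒜) (P Q : Point k ℤ) (hP : Even P.x) (hQ : Odd Q.x) :
    ∃ x : AdelicPoint k, pairing 𝒜 x ≠ 0 := by
  by_contra! hall
  let inv (R : Point k ℤ) (p : Nat.Primes) : AddCircle (1 : ℚ) :=
    have : Fact (p : ℕ).Prime := ⟨p.2⟩
    localInv 𝒜 (R.ofInt ℚ_[(p : ℕ)])
  let g (f : ℕ → Point k ℤ) (p : Nat.Primes) : AddCircle (1 : ℚ) := inv (f p) p
  have hpair : ∀ f, pairing 𝒜 (AdelicPoint.ofInt P f) = localInv 𝒜 (P.ofInt ℝ) + ∑ᶠ p, g f p := by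
    intro f
    simp only [pairing, AdelicPoint.ofInt, g, inv]
    congr 1
  let f₁ : ℕ → Point k ℤ := fun _ => P
  let f₂ : ℕ → Point k ℤ := fun p => if p = 2 then Q else P
  -- A `finsum` with infinite support is 0 by default, so finiteness is needed before subtracting
  -- the sums. Away from 2, only primes dividing the entries of the quaternion algebra at P can
  -- contribute.
  have hfin : ∀ f : ℕ → Point k ℤ, (∀ p, p ≠ 2 → f p = P) → (Function.support (g f)).Finite := by
    intro f hf
    have hN : (2 * (4 * P.x ^ 2 + 1) * slotTwo k) ≠ 0 :=
      mul_ne_zero (by positivity) (slotTwo_ne_zero k)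
    refine Set.Finite.subset (Set.Finite.preimage (f := fun p : Nat.Primes => (p : ℕ))
      (fun _ _ _ _ hpq => Subtype.ext hpq)
      (Set.finite_Iic (2 * (4 * P.x ^ 2 + 1) * slotTwo k).natAbs)) fun p hp => ?_
    have : Fact (p : ℕ).Prime := ⟨p.2⟩
    by_contra hlt
    have hndvd : ¬ ((p : ℕ) : ℤ) ∣ 2 * (4 * P.x ^ 2 + 1) * slotTwo k := fun hd =>
      hlt (Nat.le_of_dvd (Int.natAbs_pos.2 hN) (Int.natCast_dvd.1 hd))
    have hp2 : (p : ℕ) ≠ 2 := fun h2 => hndvd (by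
      rw [h2]
      exact dvd_mul_of_dvd_left (dvd_mul_right _ _) _)
    exact hp (by
      simp only [g, inv, hf _ hp2]
      exact if_pos (splitAt_of_not_dvd h P hndvd))
  have h₁ : (Function.support (g f₁)).Finite := hfin f₁ fun _ _ => rfl
  have h₂ : (Function.support (g f₂)).Finite := hfin f₂ fun p hp => if_neg hp
  have hsum : ∑ᶠ p, (g f₂ p - g f₁ p) = 0 := by
    rw [finsum_sub_distrib h₂ h₁, sub_eq_zero]
    have e₁ := (hpair f₁).symm.trans (hall _)
    have e₂ := (hpair f₂).symm.trans (hall _)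
    exact add_left_cancel (e₂.trans e₁.symm)
  have hsingle : ∑ᶠ p, (g f₂ p - g f₁ p) = g f₂ ⟨2, Nat.prime_two⟩ - g f₁ ⟨2, Nat.prime_two⟩ :=
    finsum_eq_single _ _ fun p hp => by
      have : (p : ℕ) ≠ 2 := fun h2 => hp (Subtype.ext h2)
      simp [g, f₁, f₂, this]
  refine one_half_ne_zero ?_
  have i₁ : g f₁ ⟨2, Nat.prime_two⟩ = 0 := if_pos (splitAt_two_of_even h P hP)
  have i₂ : g f₂ ⟨2, Nat.prime_two⟩ = ((1 / 2 : ℚ) : AddCircle (1 : ℚ)) :=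
    if_neg (not_splitAt_two_of_odd h Q hQ)
  rw [← i₂, ← hsum, hsingle, i₁, sub_zero]

/-- For `k ≡ 1 mod 4`, exactly one coordinate of an integral point is odd; permuting coordinates one
finds integral points whose first coordinate has either parity. -/
theorem exists_even_odd {k : ℤ} (hk : k ≡ 1 [ZMOD 4]) (P : Point k ℤ) :
    (∃ Q : Point k ℤ, Even Q.x) ∧ ∃ Q : Point k ℤ, Odd Q.x := by
  obtain ⟨x, y, z, h⟩ := P
  have h₁ : form y z x = k := by
    rw [← show form x y z = k from h]
    simp only [form]
    ring
  have h₂ : form z x y = k := by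
    rw [← show form x y z = k from h]
    simp only [form]
    ring
  -- Modulo 4 the equation is x² + y² + z² ≡ 1, which excludes three odd and three even coordinates.
  have hs : (x ^ 2 + y ^ 2 + z ^ 2) % 4 = 1 := by
    have h' : x ^ 2 + y ^ 2 + z ^ 2
        = k + 4 * (4 * x ^ 2 * y ^ 2 * z ^ 2 - (x ^ 2 * y ^ 2 + y ^ 2 * z ^ 2 + z ^ 2 * x ^ 2)) := by
      rw [← show form x y z = k from h]
      simp only [form]
      ring
    rw [h', Int.add_mul_emod_self_left]
    exact hk
  have hev : Even x ∨ Even y ∨ Even z := by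
    by_contra! hno
    simp only [Int.not_even_iff_odd] at hno
    have := Int.sq_mod_four_eq_one_of_odd hno.1
    have := Int.sq_mod_four_eq_one_of_odd hno.2.1
    have := Int.sq_mod_four_eq_one_of_odd hno.2.2
    omega
  have hod : Odd x ∨ Odd y ∨ Odd z := by
    by_contra! hno
    simp only [Int.not_odd_iff_even] at hno
    obtain ⟨⟨a, rfl⟩, ⟨b, rfl⟩, ⟨c, rfl⟩⟩ := hno
    ring_nf at hs
    omega
  constructor
  · obtain hx | hy | hz := hev
    exacts [⟨⟨x, y, z, h⟩, hx⟩, ⟨⟨y, z, x, h₁⟩, hy⟩, ⟨⟨z, x, y, h₂⟩, hz⟩]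
  · obtain hx | hy | hz := hod
    exacts [⟨⟨x, y, z, h⟩, hx⟩, ⟨⟨y, z, x, h₁⟩, hy⟩, ⟨⟨z, x, y, h₂⟩, hz⟩]

end MarkoffK3

theorem mainTheorem10 :
    (∀ k : ℤ, k ≡ 1 [ZMOD 4] → Nonempty (MarkoffK3.Point k ℤ) →
      (∃ (𝒜 : Type) (_ : Ring 𝒜) (_ : Algebra (MarkoffK3.CoordRing k) 𝒜),
        MarkoffK3.RepresentsA₁ k 𝒜) ∧
      (∀ (𝒜 : Type) [Ring 𝒜] [Algebra (MarkoffK3.CoordRing k) 𝒜],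
        MarkoffK3.RepresentsA₁ k 𝒜 →
          MarkoffK3.brauerManinSet k 𝒜 ≠ Set.univ)) ∧
    ((-2911 : ℤ) ≡ 1 [ZMOD 4] ∧
      ∃ P : MarkoffK3.Point (-2911) ℤ, P.x = 1 ∧ P.y = 4 ∧ P.z = 4) := by
  refine ⟨fun k hk ⟨P⟩ => ⟨MarkoffK3.exists_representsA₁ k, fun 𝒜 _ _ h hU => ?_⟩, by decide,
    ⟨1, 4, 4, by norm_num [MarkoffK3.form]⟩, rfl, rfl, rfl⟩
  obtain ⟨⟨Q, hQ⟩, ⟨R, hR⟩⟩ := MarkoffK3.exists_even_odd hk P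
  obtain ⟨x, hx⟩ := MarkoffK3.exists_pairing_ne_zero h Q R hQ hR
  have hmem : x ∈ MarkoffK3.brauerManinSet k 𝒜 := hU ▸ Set.mem_univ x
  exact hx hmem
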